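/- For a finite set $S\subset\mathbb{R}^3$ and a function $r\colon S\to(0,\infty)$, let $e_r(S)$ be the number of ordered pairs $(x,y)\in S\times S$ whose Euclidean distance satisfies $d(x,y)=r(x)$, and let $f_3(n)$ be the maximum of $e_r(S)$ over all $n$-point sets $S\subset\mathbb{R}^3$ and all functions $r\colon S\to(0,\infty)$. A finite set $A\subset\mathbb{R}^3$ together with a function $r\colon A\to(0,\infty)$ is called a suspension with circle $\mathcal{C}$ and symmetry axis $\mathcal{L}$ if $\mathcal{C}$ is a circle (of positive radius) in $\mathbb{R}^3$, $\mathcal{L}$ is the line through the centre of $\mathcal{C}$ orthogonal to the plane of $\mathcal{C}$, $A\subset\mathcal{C}\cup\mathcal{L}$, and $r(x)=d(x,\mathcal{C})$ for all $x\in A\cap\mathcal{L}$, where $d(x,\mathcal{C})$ is the distance from $x$ to $\mathcal{C}$. Theorem. There is an $n_0\in\mathbb{N}$ such that the following holds. Let $S\subset\mathbb{R}^3$ be a finite set with $|S|\ge n_0$ and let $r\colon S\to(0,\infty)$ be such that $e_r(S)=f_3(|S|)$. Then there is a set $T\subseteq S$ with $|T|\le 2$ such that $S\setminus T$, with the restriction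 of $r$, is a suspension with some circle $\mathcal{C}$ and its symmetry axis $\mathcal{L}$. -/

import Mathlib

/-- Euclidean `d`-space. -/
abbrev Euc (d : ℕ) : Type := EuclideanSpace ℝ (Fin d)

/-- The arcs of the favourite distance digraph on `S` determined by `r`: all ordered pairs `(x, y)`
of points of `S` with `d(x, y) = r(x)`.  Only the values of `r` on `S` matter. -/
noncomputable def favouriteArcs {d : ℕ} (S : Finset (Euc d)) (r : Euc d → ℝ) :
    Finset (Euc d × Euc d) :=
  (S ×ˢ S).filter (fun p => dist p.1 p.2 = r p.1)

/-- `e_r(S)`, the number of arcs of the favourite distance digraph. -/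
noncomputable def favouriteCount {d : ℕ} (S : Finset (Euc d)) (r : Euc d → ℝ) : ℕ :=
  (favouriteArcs S r).card

/-- The values of `e_r(S)` over all `n`-point sets `S` in `d`-space and all assignments `r` of
positive numbers to the points of `S`. -/
def favouriteCountValues (d n : ℕ) : Set ℕ :=
  {k | ∃ (S : Finset (Euc d)) (r : Euc d → ℝ),
    S.card = n ∧ (∀ x ∈ S, 0 < r x) ∧ favouriteCount S r = k}

/-- `f_d(n)`, the maximum of `e_r(S)` over all `n`-point sets `S` in `d`-space and all `r`. -/
noncomputable def favouriteMax (d n : ℕ) : ℕ :=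
  sSup (favouriteCountValues d n)

theorem favouriteCountValues_bddAbove (d n : ℕ) : BddAbove (favouriteCountValues d n) := by
  refine ⟨n * n, ?_⟩
  rintro k ⟨S, r, hS, -, rfl⟩
  calc favouriteCount S r ≤ (S ×ˢ S).card := Finset.card_filter_le _ _
    _ = n * n := by rw [Finset.card_product, hS]

/-- For `d ≥ 1` the supremum defining `f_d(n)` is an attained maximum. -/
theorem favouriteMax_isGreatest (d n : ℕ) [NeZero d] :
    IsGreatest (favouriteCountValues d n) (favouriteMax d n) := by
  have hne : (favouriteCountValues d n).Nonempty := by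
    haveI : Infinite (Euc d) := Module.Free.infinite ℝ (Euc d)
    obtain ⟨S, hS⟩ := Infinite.exists_subset_card_eq (Euc d) n
    exact ⟨_, S, fun _ => 1, hS, fun _ _ => one_pos, rfl⟩
  exact ⟨Nat.sSup_mem hne (favouriteCountValues_bddAbove d n),
    fun k hk => le_csSup (favouriteCountValues_bddAbove d n) hk⟩

/-- A (nondegenerate) circle in 3-space, given by its centre, a nonzero normal vector of its plane,
and its positive radius. -/
structure Circle3 where
  center : Euc 3
  normal : Euc 3
  radius : ℝ
  normal_ne_zero : normal ≠ 0
  radius_pos : 0 < radius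

/-- The points of the circle. -/
def Circle3.points (C : Circle3) : Set (Euc 3) :=
  {x | dist x C.center = C.radius ∧ inner ℝ (x - C.center) C.normal = 0}

/-- The axis of symmetry of the circle: the line through its centre orthogonal to its plane. -/
def Circle3.axis (C : Circle3) : Set (Euc 3) :=
  {x | ∃ t : ℝ, x = C.center + t • C.normal}

/-- The set `A` with the function `r` is a suspension with circle `C`. -/
structure IsSuspensionWith (C : Circle3) (A : Set (Euc 3)) (r : Euc 3 → ℝ) : Prop where
  finite : A.Finite
  pos : ∀ x ∈ A, 0 < r x
  subset : A ⊆ C.points ∪ C.axis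
  dist_eq : ∀ x ∈ A ∩ C.axis, r x = Metric.infDist x C.points

/-!
Write `n = |S|`, and let `x → y` mean that `y` lies on the sphere around `x` of radius `r x`.

If two of these spheres share three points, they meet in a circle, and every point with arcs to
three points of this circle lies on its axis and has arcs to the whole circle
(`dist_eq_of_three_common`). Points on a sphere are not collinear, so a point cannot have arcs to
three points all of which have arcs to the same three points (`not_three_arcs_three_arcs`).

*Stability* (`exists_dominant_circle`, `exists_circle_of_sq_card_le`). Suppose that there are at
least `n² / 4` arcs. Call a circle rich if it contains a fixed small proportion of `S` and a fixed
small proportion of `S` has arcs to all of these points. By counting triples of points with a common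
out-neighbour, all but few arcs go from the axis of a rich circle to that circle. By the above facts
the unions `U` of a rich circle and its axis pairwise share at most seven points, so there are
boundedly many of them and `∑ |U| ≤ n + O(1)`. As each of them carries at most `|U|² / 4` arcs, some
`U` has at least `0.95 n` points.

*Counting arcs*. Fix that circle. Let it have `c` points of `S`, let `a` points on its axis have
arcs to the circle, and let `k ≤ n / 20` points be left over; these form the set to be removed.
Points on the axis have `a c` arcs to the circle. Every other point receives at most one arc from
the axis, since the spheres containing the circle are disjoint elsewhere. A point of the circle has
at most two arcs to the circle and two arcs to the axis; and since three exceptional points have at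
most two common in-neighbours on the circle, it has on average essentially at most two arcs (at most
`k / 4` arcs if `k` is large) to exceptional points. An exceptional point has at most `4 + k` arcs.
If `k ≥ 3` this adds up to at most `n² / 4 + 2n + O(1)` (`card_exceptional_le_two`).

*Lower bound* (`le_favouriteMax`). On the other hand `f₃(n) ≥ n² / 4 + 5n / 2 - O(1)`. On the unit
circle take points at angles `0, 2, 4, …`, with `r` the distance between consecutive points. On the
axis take two symmetric points at this same distance from the circle, and from there upwards a chain
in which the distance to the next point equals the distance to the circle. Up to boundedly many
exceptions a point of the circle has two arcs to the circle and two to the axis, and a point on the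
axis has an arc to its successor.
-/

/-! ### Circles, their axes, and spheres -/

/-- Three distinct points on a sphere span a plane, so that up to scaling they have exactly one
normal vector. -/
theorem exists_normal_of_equidistant {p z₁ z₂ z₃ : Euc 3} {ρ : ℝ} (h₁₂ : z₁ ≠ z₂) (h₁₃ : z₁ ≠ z₃)
    (h₂₃ : z₂ ≠ z₃) (h₁ : dist p z₁ = ρ) (h₂ : dist p z₂ = ρ) (h₃ : dist p z₃ = ρ) :
    ∃ w : Euc 3, w ≠ 0 ∧ inner ℝ (z₂ - z₁) w = 0 ∧ inner ℝ (z₃ - z₁) w = 0 ∧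
      ∀ u v : Euc 3, u ≠ 0 → inner ℝ (z₂ - z₁) u = 0 → inner ℝ (z₃ - z₁) u = 0 →
        inner ℝ (z₂ - z₁) v = 0 → inner ℝ (z₃ - z₁) v = 0 → ∃ t : ℝ, v = t • u := by
  have hco : EuclideanGeometry.Cospherical ({z₁, z₂, z₃} : Set (Euc 3)) := by
    refine ⟨p, ρ, ?_⟩
    rintro q (rfl | rfl | rfl) <;> rwa [dist_comm]
  have hai := hco.affineIndependent_of_ne h₁₂ h₁₃ h₂₃
  have hrank := hai.finrank_vectorSpan (n := 2) (by simp)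
  set K := vectorSpan ℝ (Set.range ![z₁, z₂, z₃]) with hK
  have hKspan : K = Submodule.span ℝ {z₂ - z₁, z₃ - z₁} := by
    rw [hK, vectorSpan_range_eq_span_range_vsub_right ℝ _ (0 : Fin 3)]
    have hr : Set.range (fun i : Fin 3 => ![z₁, z₂, z₃] i -ᵥ ![z₁, z₂, z₃] 0)
        = insert 0 {z₂ - z₁, z₃ - z₁} := by
      ext q
      simp [Fin.exists_fin_succ, eq_comm]
    rw [hr, Submodule.span_insert_zero]
  have hmem : ∀ u : Euc 3, inner ℝ (z₂ - z₁) u = 0 → inner ℝ (z₃ - z₁) u = 0 → u ∈ Kᗮ := by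
    intro u h2 h3
    rw [hKspan, Submodule.mem_orthogonal]
    intro q hq
    obtain ⟨a, b, rfl⟩ := Submodule.mem_span_pair.1 hq
    simp [inner_add_left, inner_smul_left, h2, h3]
  have hone : Module.finrank ℝ Kᗮ = 1 := by
    have h := Submodule.finrank_add_finrank_orthogonal K
    rw [hrank, finrank_euclideanSpace_fin] at h
    omega
  obtain ⟨⟨w, hwK⟩, hw0, -⟩ := finrank_eq_one_iff'.1 hone
  have hperp : ∀ q ∈ K, inner ℝ q w = 0 := fun q hq => (Submodule.mem_orthogonal K w).1 hwK q hq
  refine ⟨w, by simpa using hw0, hperp _ ?_, hperp _ ?_, ?_⟩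
  · rw [hKspan]; exact Submodule.subset_span (by simp)
  · rw [hKspan]; exact Submodule.subset_span (by simp)
  · intro u v hu hu2 hu3 hv2 hv3
    obtain ⟨t, ht⟩ := (finrank_eq_one_iff_of_nonzero' (⟨u, hmem u hu2 hu3⟩ : Kᗮ)
      (by simpa using hu)).1 hone ⟨v, hmem v hv2 hv3⟩
    exact ⟨t, by simpa using (congrArg Subtype.val ht).symm⟩

/-- The common distance from a point of the axis to the points of the circle (Pythagoras). -/
theorem Circle3.dist_sq_of_mem_points (C : Circle3) {z : Euc 3} (hz : z ∈ C.points) (t : ℝ) :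
    dist (C.center + t • C.normal) z ^ 2 = C.radius ^ 2 + t ^ 2 * ‖C.normal‖ ^ 2 := by
  have h : C.center + t • C.normal - z = t • C.normal - (z - C.center) := by abel
  rw [dist_eq_norm, h, norm_sub_sq_real, real_inner_smul_left, real_inner_comm, hz.2, norm_smul,
    ← dist_eq_norm z, hz.1, mul_pow, Real.norm_eq_abs, sq_abs]
  ring

theorem Circle3.dist_eq_dist_of_mem_axis (C : Circle3) {x z z' : Euc 3} (hx : x ∈ C.axis)
    (hz : z ∈ C.points) (hz' : z' ∈ C.points) : dist x z = dist x z' := by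
  obtain ⟨t, rfl⟩ := hx
  rw [← sq_eq_sq₀ dist_nonneg dist_nonneg, C.dist_sq_of_mem_points hz, C.dist_sq_of_mem_points hz']

theorem Circle3.infDist_eq_dist_of_mem_axis (C : Circle3) {x z : Euc 3} (hx : x ∈ C.axis)
    (hz : z ∈ C.points) : Metric.infDist x C.points = dist x z :=
  le_antisymm (Metric.infDist_le_dist_of_mem hz)
    ((Metric.le_infDist ⟨z, hz⟩).2 fun _ hz' => (C.dist_eq_dist_of_mem_axis hx hz hz').le)

theorem Circle3.disjoint_points_axis (C : Circle3) {x : Euc 3} (hx : x ∈ C.axis) :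
    x ∉ C.points := by
  rintro ⟨h₁, h₂⟩
  obtain ⟨t, rfl⟩ := hx
  have hn := C.normal_ne_zero
  have hR := C.radius_pos
  rw [add_sub_cancel_left, real_inner_smul_left, real_inner_self_eq_norm_sq] at h₂
  have ht : t = 0 := by simpa [hn] using h₂
  subst ht
  simp at h₁
  exact hR.ne h₁

/-- A point having the same distance from three points of a circle lies on its axis. -/
theorem Circle3.mem_axis_of_equidistant (C : Circle3) {p z₁ z₂ z₃ : Euc 3} {ρ : ℝ}
    (h₁₂ : z₁ ≠ z₂) (h₁₃ : z₁ ≠ z₃) (h₂₃ : z₂ ≠ z₃)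
    (hz₁ : z₁ ∈ C.points) (hz₂ : z₂ ∈ C.points) (hz₃ : z₃ ∈ C.points)
    (h₁ : dist p z₁ = ρ) (h₂ : dist p z₂ = ρ) (h₃ : dist p z₃ = ρ) : p ∈ C.axis := by
  obtain ⟨w, -, -, -, hw⟩ := exists_normal_of_equidistant h₁₂ h₁₃ h₂₃ h₁ h₂ h₃
  have hn : ∀ z ∈ C.points, inner ℝ (z - z₁) C.normal = 0 := by
    intro z hz
    have : z - z₁ = (z - C.center) - (z₁ - C.center) := by abel
    rw [this, inner_sub_left, hz.2, hz₁.2, sub_zero]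
  have hp : ∀ z ∈ C.points, dist p z = ρ → inner ℝ (z - z₁) (p - C.center) = 0 := by
    intro z hz h
    have := EuclideanGeometry.inner_vsub_vsub_of_dist_eq_of_dist_eq
      (c₁ := C.center) (c₂ := p) (p₁ := z₁) (p₂ := z) (by rw [hz₁.1, hz.1])
      (by rw [dist_comm, h₁, dist_comm, h])
    rw [real_inner_comm]
    simpa using this
  obtain ⟨t, ht⟩ := hw C.normal (p - C.center) C.normal_ne_zero (hn _ hz₂) (hn _ hz₃)
    (hp _ hz₂ h₂) (hp _ hz₃ h₃)
  exact ⟨t, by rw [← ht]; abel⟩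

/-- Three distinct points on a sphere lie on a circle. -/
theorem exists_circle_of_equidistant {p z₁ z₂ z₃ : Euc 3} {ρ : ℝ} (h₁₂ : z₁ ≠ z₂) (h₁₃ : z₁ ≠ z₃)
    (h₂₃ : z₂ ≠ z₃) (h₁ : dist p z₁ = ρ) (h₂ : dist p z₂ = ρ) (h₃ : dist p z₃ = ρ) :
    ∃ C : Circle3, z₁ ∈ C.points ∧ z₂ ∈ C.points ∧ z₃ ∈ C.points := by
  obtain ⟨w, hw0, hw2, hw3, -⟩ := exists_normal_of_equidistant h₁₂ h₁₃ h₂₃ h₁ h₂ h₃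
  -- the centre is the foot of the perpendicular from `p` to the plane of the three points
  set t : ℝ := inner ℝ (z₁ - p) w / ‖w‖ ^ 2 with ht
  have hwn : ‖w‖ ^ 2 ≠ 0 := by simpa using hw0
  have hin : ∀ z, inner ℝ (z - z₁) w = 0 → inner ℝ (z - (p + t • w)) w = 0 := by
    intro z hz
    have : z - (p + t • w) = (z - z₁) + (z₁ - p) - t • w := by abel
    rw [this, inner_sub_left, inner_add_left, hz, real_inner_smul_left, real_inner_self_eq_norm_sq,
      ht, div_mul_cancel₀ _ hwn]
    ring
  have hd : ∀ z, inner ℝ (z - z₁) w = 0 → dist p z = ρ →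
      dist z (p + t • w) ^ 2 = ρ ^ 2 - t ^ 2 * ‖w‖ ^ 2 := by
    intro z hz hρ
    have h := hin z hz
    have : p - z = -((z - (p + t • w)) + t • w) := by abel
    rw [← hρ, dist_eq_norm p z, this, norm_neg, norm_add_sq_real, real_inner_smul_right, h,
      norm_smul, mul_pow, Real.norm_eq_abs, sq_abs, dist_eq_norm]
    ring
  have hz1 : inner ℝ (z₁ - z₁) w = 0 := by simp
  have hdist : ∀ z, inner ℝ (z - z₁) w = 0 → dist p z = ρ →
      dist z (p + t • w) = dist z₁ (p + t • w) := by
    intro z hz hρ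
    rw [← sq_eq_sq₀ dist_nonneg dist_nonneg, hd z hz hρ, hd z₁ hz1 h₁]
  have hpos : 0 < dist z₁ (p + t • w) := by
    refine dist_pos.2 fun h0 => ?_
    have h := hdist z₂ hw2 h₂
    rw [← h0, dist_self, dist_eq_zero] at h
    exact h₁₂ h.symm
  exact ⟨⟨p + t • w, w, _, hw0, hpos⟩, ⟨rfl, hin _ hz1⟩, ⟨hdist _ hw2 h₂, hin _ hw2⟩,
    ⟨hdist _ hw3 h₃, hin _ hw3⟩⟩

/-- Two spheres around distinct points of the axis that contain the circle meet only in the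
circle. -/
theorem Circle3.mem_points_of_dist_eq (C : Circle3) {x x' z y : Euc 3} (hx : x ∈ C.axis)
    (hx' : x' ∈ C.axis) (hne : x ≠ x') (hz : z ∈ C.points) (h : dist x y = dist x z)
    (h' : dist x' y = dist x' z) : y ∈ C.points := by
  obtain ⟨s, rfl⟩ := hx
  obtain ⟨s', rfl⟩ := hx'
  have hss : s ≠ s' := by rintro rfl; exact hne rfl
  have key : ∀ t : ℝ, dist (C.center + t • C.normal) y ^ 2 =
      dist y C.center ^ 2 - 2 * t * inner ℝ (y - C.center) C.normal + t ^ 2 * ‖C.normal‖ ^ 2 := by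
    intro t
    have h : C.center + t • C.normal - y = t • C.normal - (y - C.center) := by abel
    rw [dist_eq_norm, h, norm_sub_sq_real, real_inner_smul_left, real_inner_comm, norm_smul,
      ← dist_eq_norm y, mul_pow, Real.norm_eq_abs, sq_abs]
    ring
  have e1 := key s
  have e2 := key s'
  rw [h, C.dist_sq_of_mem_points hz] at e1
  rw [h', C.dist_sq_of_mem_points hz] at e2
  have hi : inner ℝ (y - C.center) C.normal = 0 := by
    have : (s - s') * inner ℝ (y - C.center) C.normal = 0 := by linarith
    exact (mul_eq_zero.1 this).resolve_left (sub_ne_zero.2 hss)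
  rw [hi] at e1
  exact ⟨(sq_eq_sq₀ dist_nonneg C.radius_pos.le).1 (by linarith), hi⟩

/-- A sphere meets a line in at most two points. -/
theorem Circle3.not_three_axis_equidistant (C : Circle3) {p y₁ y₂ y₃ : Euc 3} {ρ : ℝ}
    (h₁₂ : y₁ ≠ y₂) (h₁₃ : y₁ ≠ y₃) (h₂₃ : y₂ ≠ y₃)
    (hy₁ : y₁ ∈ C.axis) (hy₂ : y₂ ∈ C.axis) (hy₃ : y₃ ∈ C.axis)
    (h₁ : dist p y₁ = ρ) (h₂ : dist p y₂ = ρ) (h₃ : dist p y₃ = ρ) : False := by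
  obtain ⟨a, rfl⟩ := hy₁
  obtain ⟨b, rfl⟩ := hy₂
  obtain ⟨c, rfl⟩ := hy₃
  have hab : a ≠ b := by rintro rfl; exact h₁₂ rfl
  have hac : a ≠ c := by rintro rfl; exact h₁₃ rfl
  have hbc : b ≠ c := by rintro rfl; exact h₂₃ rfl
  have hn : ‖C.normal‖ ^ 2 ≠ 0 := by simpa using C.normal_ne_zero
  have key : ∀ t : ℝ, dist p (C.center + t • C.normal) = ρ →
      ρ ^ 2 = ‖p - C.center‖ ^ 2 - 2 * t * inner ℝ (p - C.center) C.normal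
        + t ^ 2 * ‖C.normal‖ ^ 2 := by
    intro t ht
    have h : p - (C.center + t • C.normal) = (p - C.center) - t • C.normal := by abel
    rw [← ht, dist_eq_norm, h, norm_sub_sq_real, real_inner_smul_right, norm_smul,
      mul_pow, Real.norm_eq_abs, sq_abs]
    ring
  have e1 := key a h₁
  have e2 := key b h₂
  have e3 := key c h₃
  set i := inner ℝ (p - C.center) C.normal
  set N := ‖C.normal‖ ^ 2
  have f1 : (a + b) * N = 2 * i := by
    apply mul_left_cancel₀ (sub_ne_zero.2 hab); linarith
  have f2 : (a + c) * N = 2 * i := by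
    apply mul_left_cancel₀ (sub_ne_zero.2 hac); linarith
  have f3 : (b - c) * N = 0 := by linarith
  exact (mul_ne_zero (sub_ne_zero.2 hbc) hn) f3

/-- If two spheres with distinct centres share three points, then every sphere through these three
points contains the whole intersection of the two spheres. -/
theorem dist_eq_of_three_common {x x' x'' z₁ z₂ z₃ z : Euc 3} {ρ ρ' ρ'' : ℝ} (hne : x ≠ x')
    (h₁₂ : z₁ ≠ z₂) (h₁₃ : z₁ ≠ z₃) (h₂₃ : z₂ ≠ z₃)
    (h₁ : dist x z₁ = ρ) (h₂ : dist x z₂ = ρ) (h₃ : dist x z₃ = ρ)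
    (h₁' : dist x' z₁ = ρ') (h₂' : dist x' z₂ = ρ') (h₃' : dist x' z₃ = ρ')
    (h₁'' : dist x'' z₁ = ρ'') (h₂'' : dist x'' z₂ = ρ'') (h₃'' : dist x'' z₃ = ρ'')
    (h : dist x z = ρ) (h' : dist x' z = ρ') : dist x'' z = ρ'' := by
  obtain ⟨C, c₁, c₂, c₃⟩ := exists_circle_of_equidistant h₁₂ h₁₃ h₂₃ h₁ h₂ h₃
  have hx := C.mem_axis_of_equidistant h₁₂ h₁₃ h₂₃ c₁ c₂ c₃ h₁ h₂ h₃
  have hx' := C.mem_axis_of_equidistant h₁₂ h₁₃ h₂₃ c₁ c₂ c₃ h₁' h₂' h₃'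
  have hx'' := C.mem_axis_of_equidistant h₁₂ h₁₃ h₂₃ c₁ c₂ c₃ h₁'' h₂'' h₃''
  have hz := C.mem_points_of_dist_eq hx hx' hne c₁ (h.trans h₁.symm) (h'.trans h₁'.symm)
  rw [← h₁'']
  exact C.dist_eq_dist_of_mem_axis hx'' hz c₁

/-- Three points on a sphere cannot be the centres of spheres sharing three points: the former are
not collinear, whereas the latter force their centres to lie on the axis of a circle. -/
theorem not_three_arcs_three_arcs {x y₁ y₂ y₃ z₁ z₂ z₃ : Euc 3} {ρ ρ₁ ρ₂ ρ₃ : ℝ}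
    (hy₁₂ : y₁ ≠ y₂) (hy₁₃ : y₁ ≠ y₃) (hy₂₃ : y₂ ≠ y₃)
    (hz₁₂ : z₁ ≠ z₂) (hz₁₃ : z₁ ≠ z₃) (hz₂₃ : z₂ ≠ z₃)
    (h₁ : dist x y₁ = ρ) (h₂ : dist x y₂ = ρ) (h₃ : dist x y₃ = ρ)
    (h₁₁ : dist y₁ z₁ = ρ₁) (h₁₂ : dist y₁ z₂ = ρ₁) (h₁₃ : dist y₁ z₃ = ρ₁)
    (h₂₁ : dist y₂ z₁ = ρ₂) (h₂₂ : dist y₂ z₂ = ρ₂) (h₂₃ : dist y₂ z₃ = ρ₂)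
    (h₃₁ : dist y₃ z₁ = ρ₃) (h₃₂ : dist y₃ z₂ = ρ₃) (h₃₃ : dist y₃ z₃ = ρ₃) : False := by
  obtain ⟨C, c₁, c₂, c₃⟩ := exists_circle_of_equidistant hz₁₂ hz₁₃ hz₂₃ h₁₁ h₁₂ h₁₃
  exact C.not_three_axis_equidistant hy₁₂ hy₁₃ hy₂₃
    (C.mem_axis_of_equidistant hz₁₂ hz₁₃ hz₂₃ c₁ c₂ c₃ h₁₁ h₁₂ h₁₃)
    (C.mem_axis_of_equidistant hz₁₂ hz₁₃ hz₂₃ c₁ c₂ c₃ h₂₁ h₂₂ h₂₃)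
    (C.mem_axis_of_equidistant hz₁₂ hz₁₃ hz₂₃ c₁ c₂ c₃ h₃₁ h₃₂ h₃₃) h₁ h₂ h₃

/-! ### Digraphs without crossing complete bipartite subgraphs -/

section Digraph

variable {V : Type*}

open Classical in
/-- The arcs of the digraph `E` on the vertex set `S`. -/
noncomputable def arcsOn (S : Finset V) (E : V → V → Prop) : Finset (V × V) :=
  (S ×ˢ S).filter fun p => E p.1 p.2

open Classical in
/-- The out-neighbourhood of `x` within `S`. -/
noncomputable def outNbrs (S : Finset V) (E : V → V → Prop) (x : V) : Finset V :=
  S.filter (E x)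

open Classical in
/-- The common in-neighbourhood of the set `P` within `S`. -/
noncomputable def commonIn (S : Finset V) (E : V → V → Prop) (P : Finset V) : Finset V :=
  S.filter fun x => ∀ z ∈ P, E x z

/-- Two out-neighbourhoods sharing three vertices determine a "circle", namely their intersection:
every out-neighbourhood containing these three vertices contains the circle. -/
def CommonNbrsClosed (E : V → V → Prop) : Prop :=
  ∀ x x' x'' z₁ z₂ z₃ z, x ≠ x' → z₁ ≠ z₂ → z₁ ≠ z₃ → z₂ ≠ z₃ →
    E x z₁ → E x z₂ → E x z₃ → E x' z₁ → E x' z₂ → E x' z₃ →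
    E x'' z₁ → E x'' z₂ → E x'' z₃ → E x z → E x' z → E x'' z

/-- There are no arcs from one vertex to three, all of which have arcs to three common vertices. -/
def NoTripleJoin (E : V → V → Prop) : Prop :=
  ∀ x y₁ y₂ y₃ z₁ z₂ z₃, y₁ ≠ y₂ → y₁ ≠ y₃ → y₂ ≠ y₃ → z₁ ≠ z₂ → z₁ ≠ z₃ → z₂ ≠ z₃ →
    E x y₁ → E x y₂ → E x y₃ → E y₁ z₁ → E y₁ z₂ → E y₁ z₃ → E y₂ z₁ → E y₂ z₂ → E y₂ z₃ →
    E y₃ z₁ → E y₃ z₂ → E y₃ z₃ → False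

theorem mem_outNbrs {S : Finset V} {E : V → V → Prop} {x z : V} :
    z ∈ outNbrs S E x ↔ z ∈ S ∧ E x z := by simp [outNbrs]

theorem mem_commonIn {S : Finset V} {E : V → V → Prop} {P : Finset V} {x : V} :
    x ∈ commonIn S E P ↔ x ∈ S ∧ ∀ z ∈ P, E x z := by simp [commonIn]

theorem exists_three_of_three_le_card {s : Finset V} (h : 3 ≤ s.card) :
    ∃ a ∈ s, ∃ b ∈ s, ∃ c ∈ s, a ≠ b ∧ a ≠ c ∧ b ≠ c := by
  obtain ⟨a, b, c, ha, hb, hc, hab, hac, hbc⟩ := Finset.two_lt_card_iff.1 h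
  exact ⟨a, ha, b, hb, c, hc, hab, hac, hbc⟩

/-- Sets with small pairwise intersections have almost disjoint union. -/
theorem sum_card_le_of_card_inter_le {ι : Type*} [DecidableEq V] [DecidableEq ι] (R : Finset ι)
    (U : ι → Finset V) (S : Finset V) (t : ℕ) (hU : ∀ i ∈ R, U i ⊆ S)
    (hpair : ∀ i ∈ R, ∀ j ∈ R, i ≠ j → (U i ∩ U j).card ≤ t) :
    ∑ i ∈ R, (U i).card ≤ S.card + t * R.card ^ 2 := by
  have h1 : ∑ i ∈ R, (U i).card = ∑ z ∈ S, (R.filter fun i => z ∈ U i).card := by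
    have := Finset.sum_card_bipartiteAbove_eq_sum_card_bipartiteBelow (s := R) (t := S)
      (fun i z => z ∈ U i)
    refine Eq.trans ?_ this
    refine Finset.sum_congr rfl fun i hi => ?_
    congr 1
    ext z
    simp only [Finset.bipartiteAbove, Finset.mem_filter]
    exact ⟨fun h => ⟨hU i hi h, h⟩, fun h => h.2⟩
  have h2 : ∑ z ∈ S, (R.offDiag.filter fun p => z ∈ U p.1 ∩ U p.2).card ≤ t * R.card ^ 2 := by
    have := Finset.sum_card_bipartiteAbove_eq_sum_card_bipartiteBelow (s := S) (t := R.offDiag)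
      (fun z p => z ∈ U p.1 ∩ U p.2)
    simp only [Finset.bipartiteAbove, Finset.bipartiteBelow] at this
    rw [this]
    calc ∑ p ∈ R.offDiag, (S.filter fun z => z ∈ U p.1 ∩ U p.2).card
        ≤ ∑ p ∈ R.offDiag, t := by
          refine Finset.sum_le_sum fun p hp => ?_
          obtain ⟨hi, hj, hij⟩ := Finset.mem_offDiag.1 hp
          refine (Finset.card_le_card fun z hz => ?_).trans (hpair _ hi _ hj hij)
          exact (Finset.mem_filter.1 hz).2
      _ ≤ t * R.card ^ 2 := by
          rw [Finset.sum_const, smul_eq_mul, mul_comm, Finset.offDiag_card]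
          exact Nat.mul_le_mul_left _ (by rw [sq]; exact Nat.sub_le _ _)
  have h3 : ∀ z ∈ S, (R.filter fun i => z ∈ U i).card ≤
      1 + (R.offDiag.filter fun p => z ∈ U p.1 ∩ U p.2).card := by
    intro z _
    have : (R.offDiag.filter fun p => z ∈ U p.1 ∩ U p.2) = (R.filter fun i => z ∈ U i).offDiag := by
      ext ⟨i, j⟩
      simp only [Finset.mem_filter, Finset.mem_offDiag, Finset.mem_inter]
      tauto
    rw [this, Finset.offDiag_card]
    generalize (R.filter fun i => z ∈ U i).card = m
    rcases m with _ | m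
    · simp
    · have : (m + 1) * (m + 1) - (m + 1) = m * (m + 1) := by
        rw [Nat.sub_eq_iff_eq_add (by nlinarith)]; ring
      rw [this]
      nlinarith
  calc ∑ i ∈ R, (U i).card ≤ ∑ z ∈ S, (1 + (R.offDiag.filter fun p => z ∈ U p.1 ∩ U p.2).card) :=
        h1 ▸ Finset.sum_le_sum h3
    _ ≤ S.card + t * R.card ^ 2 := by
        rw [Finset.sum_add_distrib]
        simpa using h2

/-- A dense subgraph `F` has a pair of vertices with a common out-neighbour in `F` that determines
a circle with many points and many common in-neighbours. The proof counts the triples of vertices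
with a common out-neighbour. -/
theorem exists_rich_of_card_arcsOn [DecidableEq V] {S : Finset V} {E F : V → V → Prop} {q : ℕ}
    (hE : CommonNbrsClosed E) (hFE : ∀ x z, F x z → E x z)
    (hF : (q + 3) * S.card ^ 5 < (arcsOn S F).card ^ 3) :
    ∃ x ∈ S, ∃ x' ∈ S, ∃ z ∈ S, x ≠ x' ∧ F x z ∧ F x' z ∧
      q ≤ (outNbrs S E x ∩ outNbrs S E x').card ∧
      q ≤ (commonIn S E (outNbrs S E x ∩ outNbrs S E x')).card := by
  classical
  by_contra! hcon
  set n := S.card with hn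
  let c : V → V → V → ℕ := fun x x' x'' => (S.filter fun z => F x z ∧ F x' z ∧ F x'' z).card
  let d : V → ℕ := fun z => (S.filter fun x => F x z).card
  have harcs : (arcsOn S F).card = ∑ z ∈ S, d z := by
    rw [arcsOn, Finset.card_filter, Finset.sum_product_right]
    simp only [d, Finset.card_filter]
  have hcube : ∑ z ∈ S, d z ^ 3 = ∑ x ∈ S, ∑ x' ∈ S, ∑ x'' ∈ S, c x x' x'' := by
    have h1 : ∀ z, d z ^ 3 = ∑ x ∈ S, ∑ x' ∈ S, ∑ x'' ∈ S,
        if F x z ∧ F x' z ∧ F x'' z then 1 else 0 := by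
      intro z
      simp only [d, Finset.card_filter]
      rw [pow_succ, sq, Finset.sum_mul_sum, Finset.sum_mul]
      refine Finset.sum_congr rfl fun x _ => ?_
      rw [Finset.sum_mul_sum]
      refine Finset.sum_congr rfl fun x' _ => Finset.sum_congr rfl fun x'' _ => ?_
      split_ifs <;> simp_all
    simp only [h1, c, Finset.card_filter]
    rw [Finset.sum_comm]
    refine Finset.sum_congr rfl fun x _ => ?_
    rw [Finset.sum_comm]
    refine Finset.sum_congr rfl fun x' _ => ?_
    rw [Finset.sum_comm]
  have hcn : ∀ x x' x'', c x x' x'' ≤ n := fun x x' x'' => Finset.card_filter_le _ _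
  -- triples extending a pair `x ≠ x'`: the third vertex sees at least three points of the circle
  -- determined by the pair, and hence all of it, or else it contributes at most two
  have hpair : ∀ x ∈ S, ∀ x' ∈ S, x ≠ x' → ∑ x'' ∈ S, c x x' x'' ≤ (q + 2) * n := by
    intro x hx x' hx' hne
    set P := outNbrs S E x ∩ outNbrs S E x' with hP
    by_cases hz : ∃ z ∈ S, F x z ∧ F x' z
    · obtain ⟨z, hzS, hxz, hxz'⟩ := hz
      have hcP : ∀ x'', c x x' x'' ≤ P.card := by
        intro x''
        refine Finset.card_le_card fun y hy => ?_
        obtain ⟨hyS, h1, h2, -⟩ := Finset.mem_filter.1 hy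
        exact Finset.mem_inter.2 ⟨mem_outNbrs.2 ⟨hyS, hFE _ _ h1⟩, mem_outNbrs.2 ⟨hyS, hFE _ _ h2⟩⟩
      by_cases hq : q ≤ P.card
      · have hL := hcon x hx x' hx' z hzS hne hxz hxz' hq
        have hcL : ∀ x'' ∈ S, c x x' x'' ≤ 2 + if x'' ∈ commonIn S E P then n else 0 := by
          intro x'' hx''
          by_cases h3 : 3 ≤ c x x' x''
          · have : x'' ∈ commonIn S E P := by
              obtain ⟨z₁, hz₁, z₂, hz₂, z₃, hz₃, h12, h13, h23⟩ := exists_three_of_three_le_card h3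
              simp only [Finset.mem_filter] at hz₁ hz₂ hz₃
              refine mem_commonIn.2 ⟨hx'', fun y hy => ?_⟩
              obtain ⟨hy1, hy2⟩ := Finset.mem_inter.1 hy
              exact hE x x' x'' z₁ z₂ z₃ y hne h12 h13 h23 (hFE _ _ hz₁.2.1) (hFE _ _ hz₂.2.1)
                (hFE _ _ hz₃.2.1) (hFE _ _ hz₁.2.2.1) (hFE _ _ hz₂.2.2.1) (hFE _ _ hz₃.2.2.1)
                (hFE _ _ hz₁.2.2.2) (hFE _ _ hz₂.2.2.2) (hFE _ _ hz₃.2.2.2)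
                (mem_outNbrs.1 hy1).2 (mem_outNbrs.1 hy2).2
            rw [if_pos this]
            exact (hcn _ _ _).trans (Nat.le_add_left _ _)
          · omega
        calc ∑ x'' ∈ S, c x x' x'' ≤ ∑ x'' ∈ S, (2 + if x'' ∈ commonIn S E P then n else 0) :=
              Finset.sum_le_sum hcL
          _ = 2 * n + (commonIn S E P).card * n := by
              rw [Finset.sum_add_distrib, ← Finset.sum_filter, Finset.sum_const, Finset.sum_const,
                smul_eq_mul, smul_eq_mul, mul_comm, ← hn, Finset.filter_mem_eq_inter,
                Finset.inter_eq_right.2 fun y hy => (mem_commonIn.1 hy).1]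
          _ ≤ (q + 2) * n := by nlinarith
      · calc ∑ x'' ∈ S, c x x' x'' ≤ ∑ x'' ∈ S, q :=
              Finset.sum_le_sum fun x'' _ => (hcP x'').trans (not_le.1 hq).le
          _ ≤ (q + 2) * n := by rw [Finset.sum_const, smul_eq_mul, ← hn]; nlinarith
    · have : ∀ x'' ∈ S, c x x' x'' = 0 := by
        intro x'' _
        refine Finset.card_eq_zero.2 (Finset.filter_eq_empty_iff.2 fun y hy h => hz ⟨y, hy, h.1, h.2.1⟩)
      rw [Finset.sum_eq_zero this]
      exact Nat.zero_le _
  have hrow : ∀ x ∈ S, ∑ x' ∈ S, ∑ x'' ∈ S, c x x' x'' ≤ (q + 3) * n ^ 2 := by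
    intro x hx
    rw [← Finset.sum_erase_add _ _ hx]
    have h1 : ∑ x' ∈ S.erase x, ∑ x'' ∈ S, c x x' x'' ≤ n * ((q + 2) * n) := by
      calc _ ≤ ∑ x' ∈ S.erase x, (q + 2) * n := Finset.sum_le_sum fun x' hx' =>
            hpair x hx x' (Finset.mem_of_mem_erase hx') (Finset.ne_of_mem_erase hx').symm
        _ ≤ n * ((q + 2) * n) := by
            rw [Finset.sum_const, smul_eq_mul]
            exact Nat.mul_le_mul_right _ (Finset.card_le_card (Finset.erase_subset _ _))
    have h2 : ∑ x'' ∈ S, c x x x'' ≤ n * n := by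
      calc _ ≤ ∑ x'' ∈ S, n := Finset.sum_le_sum fun x'' _ => hcn _ _ _
        _ = n * n := by rw [Finset.sum_const, smul_eq_mul]
    nlinarith
  have htot : ∑ z ∈ S, d z ^ 3 ≤ (q + 3) * n ^ 3 := by
    rw [hcube]
    calc _ ≤ ∑ x ∈ S, (q + 3) * n ^ 2 := Finset.sum_le_sum hrow
      _ = (q + 3) * n ^ 3 := by rw [Finset.sum_const, smul_eq_mul]; ring
  have hmean : (∑ z ∈ S, d z) ^ 3 ≤ n ^ 2 * ∑ z ∈ S, d z ^ 3 := by
    have h := pow_sum_le_card_mul_sum_pow (s := S) (f := fun z => (d z : ℝ))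
      (fun _ _ => Nat.cast_nonneg _) 2
    exact_mod_cast h
  rw [harcs] at hF
  have : n ^ 2 * ∑ z ∈ S, d z ^ 3 ≤ n ^ 2 * ((q + 3) * n ^ 3) := Nat.mul_le_mul_left _ htot
  have h5 : n ^ 2 * ((q + 3) * n ^ 3) = (q + 3) * n ^ 5 := by ring
  omega

/-- A digraph with the incidence properties of circles and their axes and with at least `n² / 4`
arcs is dominated by the arcs from the axis to the points of a single circle. The rich circles have
small pairwise overlaps, so that their sizes sum up to little more than `n`; since they carry almost
all arcs, one of them has almost all vertices. -/
theorem exists_dominant_circle [DecidableEq V] {S : Finset V} {E : V → V → Prop}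
    (hE : CommonNbrsClosed E) (hE' : NoTripleJoin E) (hirr : ∀ x ∈ S, ¬ E x x)
    (hn : 10 ^ 15 ≤ S.card) (hS : S.card ^ 2 ≤ 4 * (arcsOn S E).card) :
    ∃ x ∈ S, ∃ x' ∈ S, x ≠ x' ∧ 3 ≤ (outNbrs S E x ∩ outNbrs S E x').card ∧
      19 * S.card ≤ 20 * ((commonIn S E (outNbrs S E x ∩ outNbrs S E x')).card +
        (outNbrs S E x ∩ outNbrs S E x').card) := by
  classical
  set n := S.card with hnS
  -- the threshold for rich circles, small enough that any `n² / 100` arcs produce a rich circle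
  obtain ⟨q, hq⟩ : ∃ q, q = n / 10 ^ 6 - 3 := ⟨_, rfl⟩
  have hq3 : 3 ≤ q := by omega
  let Rich : Finset V → Prop := fun P => ∃ x ∈ S, ∃ x' ∈ S, x ≠ x' ∧
    P = outNbrs S E x ∩ outNbrs S E x' ∧ q ≤ P.card ∧ q ≤ (commonIn S E P).card
  let R : Finset (Finset V) := S.powerset.filter Rich
  have hRich : ∀ P ∈ R, Rich P := fun P hP => (Finset.mem_filter.1 hP).2
  by_contra! hcon
  have hsmall : ∀ P ∈ R, 20 * ((commonIn S E P).card + P.card) < 19 * n := by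
    intro P hP
    obtain ⟨x, hx, x', hx', hne, rfl, hqP, -⟩ := hRich P hP
    exact hcon x hx x' hx' hne (hq3.trans hqP)
  -- an out-neighbourhood contains a rich circle as soon as it contains three of its points
  have hclosed : ∀ P, Rich P → ∀ u, ∀ z₁ ∈ P, ∀ z₂ ∈ P, ∀ z₃ ∈ P, z₁ ≠ z₂ → z₁ ≠ z₃ → z₂ ≠ z₃ →
      E u z₁ → E u z₂ → E u z₃ → ∀ z ∈ P, E u z := by
    rintro P ⟨x, hx, x', hx', hne, rfl, -, -⟩ u z₁ hz₁ z₂ hz₂ z₃ hz₃ h12 h13 h23 h1 h2 h3 z hz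
    simp only [Finset.mem_inter, mem_outNbrs] at hz₁ hz₂ hz₃ hz
    exact hE x x' u z₁ z₂ z₃ z hne h12 h13 h23 hz₁.1.2 hz₂.1.2 hz₃.1.2 hz₁.2.2 hz₂.2.2 hz₃.2.2
      h1 h2 h3 hz.1.2 hz.2.2
  -- two points of the axis of a rich circle determine it
  have haxis : ∀ P, Rich P → ∀ u ∈ commonIn S E P, ∀ u' ∈ commonIn S E P, u ≠ u' →
      P = outNbrs S E u ∩ outNbrs S E u' := by
    rintro P hP u hu u' hu' huu
    obtain ⟨x, hx, x', hx', hne, rfl, hqP, -⟩ := hP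
    obtain ⟨z₁, hz₁, z₂, hz₂, z₃, hz₃, h12, h13, h23⟩ := exists_three_of_three_le_card (hq3.trans hqP)
    have hu₁ := (mem_commonIn.1 hu).2
    have hu₂ := (mem_commonIn.1 hu').2
    ext z
    constructor
    · intro hz
      have hzS := (mem_outNbrs.1 (Finset.mem_inter.1 hz).1).1
      exact Finset.mem_inter.2 ⟨mem_outNbrs.2 ⟨hzS, hu₁ z hz⟩, mem_outNbrs.2 ⟨hzS, hu₂ z hz⟩⟩
    · intro hz
      simp only [Finset.mem_inter, mem_outNbrs] at hz
      have e1 := hu₁ _ hz₁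
      have e2 := hu₁ _ hz₂
      have e3 := hu₁ _ hz₃
      have f1 := hu₂ _ hz₁
      have f2 := hu₂ _ hz₂
      have f3 := hu₂ _ hz₃
      simp only [Finset.mem_inter, mem_outNbrs] at hz₁ hz₂ hz₃ ⊢
      exact ⟨⟨hz.1.1, hE u u' x z₁ z₂ z₃ z huu h12 h13 h23 e1 e2 e3 f1 f2 f3
        hz₁.1.2 hz₂.1.2 hz₃.1.2 hz.1.2 hz.2.2⟩, ⟨hz.1.1, hE u u' x' z₁ z₂ z₃ z huu h12 h13 h23
        e1 e2 e3 f1 f2 f3 hz₁.2.2 hz₂.2.2 hz₃.2.2 hz.1.2 hz.2.2⟩⟩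
  have hsub : ∀ P, Rich P → ∀ Q, Rich Q → 3 ≤ (P ∩ Q).card → P ⊆ Q := by
    intro P hP Q hQ h3 z hz
    obtain ⟨z₁, hz₁, z₂, hz₂, z₃, hz₃, h12, h13, h23⟩ := exists_three_of_three_le_card h3
    obtain ⟨x, hx, x', hx', hne, rfl, hqP, -⟩ := hQ
    have hcl := fun u => hclosed P hP u z₁ (Finset.mem_inter.1 hz₁).1 z₂ (Finset.mem_inter.1 hz₂).1
      z₃ (Finset.mem_inter.1 hz₃).1 h12 h13 h23
    have hzS : z ∈ S := by
      obtain ⟨y, -, y', -, -, rfl, -⟩ := hP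
      exact (mem_outNbrs.1 (Finset.mem_inter.1 hz).1).1
    simp only [Finset.mem_inter, mem_outNbrs] at hz₁ hz₂ hz₃ ⊢
    exact ⟨⟨hzS, hcl x hz₁.2.1.2 hz₂.2.1.2 hz₃.2.1.2 z hz⟩,
      ⟨hzS, hcl x' hz₁.2.2.2 hz₂.2.2.2 hz₃.2.2.2 z hz⟩⟩
  have hPQ : ∀ P, Rich P → ∀ Q, Rich Q → P ≠ Q → (P ∩ Q).card ≤ 2 := by
    intro P hP Q hQ hne
    by_contra! h3
    exact hne (Finset.Subset.antisymm (hsub P hP Q hQ h3)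
      (hsub Q hQ P hP (by rwa [Finset.inter_comm])))
  have hLL : ∀ P, Rich P → ∀ Q, Rich Q → P ≠ Q → (commonIn S E P ∩ commonIn S E Q).card ≤ 1 := by
    intro P hP Q hQ hne
    by_contra! h2
    obtain ⟨u, hu, u', hu', huu⟩ := Finset.one_lt_card.1 h2
    rw [Finset.mem_inter] at hu hu'
    exact hne ((haxis P hP u hu.1 u' hu'.1 huu).trans (haxis Q hQ u hu.2 u' hu'.2 huu).symm)
  have hPL : ∀ P, Rich P → ∀ Q, Rich Q → (P ∩ commonIn S E Q).card ≤ 2 := by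
    intro P hP Q hQ
    by_contra! h3
    obtain ⟨y₁, hy₁, y₂, hy₂, y₃, hy₃, h12, h13, h23⟩ := exists_three_of_three_le_card h3
    obtain ⟨-, -, -, -, -, -, hqQ, -⟩ := hQ
    obtain ⟨z₁, hz₁, z₂, hz₂, z₃, hz₃, k12, k13, k23⟩ := exists_three_of_three_le_card (hq3.trans hqQ)
    obtain ⟨x, -, x', -, -, rfl, -⟩ := hP
    simp only [Finset.mem_inter, mem_outNbrs, mem_commonIn] at hy₁ hy₂ hy₃
    exact hE' x y₁ y₂ y₃ z₁ z₂ z₃ h12 h13 h23 k12 k13 k23 hy₁.1.1.2 hy₂.1.1.2 hy₃.1.1.2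
      (hy₁.2.2 _ hz₁) (hy₁.2.2 _ hz₂) (hy₁.2.2 _ hz₃) (hy₂.2.2 _ hz₁) (hy₂.2.2 _ hz₂)
      (hy₂.2.2 _ hz₃) (hy₃.2.2 _ hz₁) (hy₃.2.2 _ hz₂) (hy₃.2.2 _ hz₃)
  let U : Finset V → Finset V := fun P => commonIn S E P ∪ P
  have hUcard : ∀ P ∈ R, (U P).card = (commonIn S E P).card + P.card := by
    intro P hP
    refine Finset.card_union_of_disjoint (Finset.disjoint_left.2 fun z hz hzP => ?_)
    exact hirr z (mem_commonIn.1 hz).1 ((mem_commonIn.1 hz).2 z hzP)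
  have hUS : ∀ P ∈ R, U P ⊆ S := fun P hP => Finset.union_subset
    (fun z hz => (mem_commonIn.1 hz).1) (Finset.mem_powerset.1 (Finset.mem_filter.1 hP).1)
  have hUU : ∀ P ∈ R, ∀ Q ∈ R, P ≠ Q → (U P ∩ U Q).card ≤ 7 := by
    intro P hP Q hQ hne
    have hP := hRich P hP
    have hQ := hRich Q hQ
    have h1 := hLL P hP Q hQ hne
    have h2 := hPL P hP Q hQ
    have h3 := hPL Q hQ P hP
    have h4 := hPQ P hP Q hQ hne
    have hsub : U P ∩ U Q ⊆ ((commonIn S E P ∩ commonIn S E Q) ∪ (P ∩ commonIn S E Q)) ∪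
        ((Q ∩ commonIn S E P) ∪ (P ∩ Q)) := by
      intro z
      simp only [U, Finset.mem_inter, Finset.mem_union]
      tauto
    have g := Finset.card_le_card hsub
    have g1 := Finset.card_union_le ((commonIn S E P ∩ commonIn S E Q) ∪ (P ∩ commonIn S E Q))
      ((Q ∩ commonIn S E P) ∪ (P ∩ Q))
    have g2 := Finset.card_union_le (commonIn S E P ∩ commonIn S E Q) (P ∩ commonIn S E Q)
    have g3 := Finset.card_union_le (Q ∩ commonIn S E P) (P ∩ Q)
    omega
  -- there are boundedly many rich circles
  have hRcard : R.card ≤ 10 ^ 6 := by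
    by_contra! hlt
    obtain ⟨R', hR', hcard⟩ := Finset.exists_subset_card_eq hlt.le
    have h := sum_card_le_of_card_inter_le R' U S 7 (fun P hP => hUS P (hR' hP))
      (fun P hP Q hQ => hUU P (hR' hP) Q (hR' hQ))
    have h2 : R'.card * (2 * q) ≤ ∑ P ∈ R', (U P).card := by
      rw [← smul_eq_mul]
      refine Finset.card_nsmul_le_sum _ _ _ fun P hP => ?_
      rw [hUcard P (hR' hP)]
      obtain ⟨-, -, -, -, -, -, h1, h2⟩ := hRich P (hR' hP)
      omega
    rw [hcard] at h h2
    omega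
  have hsum := sum_card_le_of_card_inter_le R U S 7 hUS hUU
  have hsum' : ∑ P ∈ R, (U P).card ≤ n + 7 * 10 ^ 12 := by
    have : R.card ^ 2 ≤ (10 ^ 6) ^ 2 := Nat.pow_le_pow_left hRcard 2
    omega
  -- the arcs not carried by rich circles
  let F : V → V → Prop := fun x z => E x z ∧ ∀ P ∈ R, ¬ (x ∈ commonIn S E P ∧ z ∈ P)
  have hF : 100 * (arcsOn S F).card ≤ n ^ 2 := by
    by_contra! hlt
    have hFlt : (q + 3) * n ^ 5 < (arcsOn S F).card ^ 3 := by
      have h1 : (q + 3) * 10 ^ 6 ≤ n := by omega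
      have h2 : (n ^ 2) ^ 3 < (100 * (arcsOn S F).card) ^ 3 := Nat.pow_lt_pow_left hlt (by norm_num)
      have h3 : (q + 3) * 10 ^ 6 * n ^ 5 ≤ n * n ^ 5 := Nat.mul_le_mul_right _ h1
      have h4 : n * n ^ 5 = (n ^ 2) ^ 3 := by ring
      have h5 : (100 * (arcsOn S F).card) ^ 3 = 10 ^ 6 * (arcsOn S F).card ^ 3 := by ring
      have h6 : (q + 3) * 10 ^ 6 * n ^ 5 = 10 ^ 6 * ((q + 3) * n ^ 5) := by ring
      omega
    obtain ⟨x, hx, x', hx', z, hz, hne, hxz, hxz', hq1, hq2⟩ :=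
      exists_rich_of_card_arcsOn hE (fun x z h => h.1) hFlt
    refine hxz.2 (outNbrs S E x ∩ outNbrs S E x') ?_ ⟨?_, ?_⟩
    · refine Finset.mem_filter.2 ⟨Finset.mem_powerset.2 fun y hy => ?_, x, hx, x', hx', hne, rfl,
        hq1, hq2⟩
      exact (mem_outNbrs.1 (Finset.mem_inter.1 hy).1).1
    · exact mem_commonIn.2 ⟨hx, fun y hy => (mem_outNbrs.1 (Finset.mem_inter.1 hy).1).2⟩
    · exact Finset.mem_inter.2 ⟨mem_outNbrs.2 ⟨hz, hxz.1⟩, mem_outNbrs.2 ⟨hz, hxz'.1⟩⟩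
  have hcover : (arcsOn S E).card ≤ (arcsOn S F).card +
      ∑ P ∈ R, (commonIn S E P).card * P.card := by
    have hsub : arcsOn S E ⊆ arcsOn S F ∪ R.biUnion fun P => commonIn S E P ×ˢ P := by
      intro p hp
      simp only [arcsOn, Finset.mem_filter, Finset.mem_union, Finset.mem_biUnion,
        Finset.mem_product] at hp ⊢
      by_cases h : ∃ P ∈ R, p.1 ∈ commonIn S E P ∧ p.2 ∈ P
      · exact Or.inr h
      · push Not at h
        exact Or.inl ⟨hp.1, hp.2, fun P hP hh => h P hP hh.1 hh.2⟩
    refine (Finset.card_le_card hsub).trans ((Finset.card_union_le _ _).trans ?_)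
    refine Nat.add_le_add_left (Finset.card_biUnion_le.trans (le_of_eq ?_)) _
    simp only [Finset.card_product]
  have hprod : 80 * ∑ P ∈ R, (commonIn S E P).card * P.card ≤ 19 * n * ∑ P ∈ R, (U P).card := by
    rw [Finset.mul_sum, Finset.mul_sum]
    refine Finset.sum_le_sum fun P hP => ?_
    have h := hsmall P hP
    rw [hUcard P hP]
    have h4 := four_mul_le_pow_two_add (commonIn S E P).card P.card
    nlinarith
  have hfin : 19 * n * ∑ P ∈ R, (U P).card ≤ 19 * n * (n + 7 * 10 ^ 12) :=
    Nat.mul_le_mul_left _ hsum'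
  nlinarith

end Digraph

/-! ### A suspension with many arcs -/

/-- The points of the unit circle at angles `0, 2, 4, …` (in radians). -/
noncomputable def circlePoint (j : ℕ) : Euc 3 :=
  !₂[Real.cos (2 * j), Real.sin (2 * j), 0]

/-- The point at height `t` on the axis of the unit circle. -/
noncomputable def axisPoint (t : ℝ) : Euc 3 :=
  !₂[0, 0, t]

/-- The height at which the points of the axis have distance `2 sin 1` from the unit circle, which
is the distance between consecutive `circlePoint`s. -/
noncomputable def axisHeight : ℝ := √(1 - 2 * Real.cos 2)

/-- Heights of points on the axis such that, except for the first one, the distance to the next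
point is the distance to the unit circle. -/
noncomputable def axisSeq : ℕ → ℝ
  | 0 => -axisHeight
  | 1 => axisHeight
  | (k + 2) => axisSeq (k + 1) + √(1 + axisSeq (k + 1) ^ 2)

open Classical in
/-- The distance to the unit circle for points on its axis, and the constant `2 sin 1` for all other
points. -/
noncomputable def suspensionRadius (x : Euc 3) : ℝ :=
  if x 0 = 0 ∧ x 1 = 0 then √(1 + x 2 ^ 2) else √(2 - 2 * Real.cos 2)

theorem axisHeight_sq : axisHeight ^ 2 = 1 - 2 * Real.cos 2 :=
  Real.sq_sqrt (by linarith [Real.cos_two_neg])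

theorem axisHeight_pos : 0 < axisHeight :=
  Real.sqrt_pos.2 (by linarith [Real.cos_two_neg])

theorem strictMono_axisSeq : StrictMono axisSeq := by
  refine strictMono_nat_of_lt_succ fun k => ?_
  rcases k with _ | k
  · change -axisHeight < axisHeight
    linarith [axisHeight_pos]
  · change axisSeq (k + 1) < axisSeq (k + 1) + √(1 + axisSeq (k + 1) ^ 2)
    have : 0 < √(1 + axisSeq (k + 1) ^ 2) := by positivity
    linarith

theorem dist_axisPoint_circlePoint (t : ℝ) (j : ℕ) :
    dist (axisPoint t) (circlePoint j) = √(1 + t ^ 2) := by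
  rw [EuclideanSpace.dist_eq, Fin.sum_univ_three]
  congr 1
  simp [axisPoint, circlePoint, Real.dist_eq]

theorem dist_axisPoint_axisPoint (s t : ℝ) : dist (axisPoint s) (axisPoint t) = |s - t| := by
  rw [EuclideanSpace.dist_eq, Fin.sum_univ_three]
  simp [axisPoint, Real.dist_eq, Real.sqrt_sq_eq_abs]

theorem dist_circlePoint_circlePoint (i j : ℕ) :
    dist (circlePoint i) (circlePoint j) = √(2 - 2 * Real.cos (2 * i - 2 * j)) := by
  rw [EuclideanSpace.dist_eq, Fin.sum_univ_three]
  congr 1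
  simp only [circlePoint, Real.dist_eq, sq_abs, Real.cos_sub]
  simp
  linarith [Real.sin_sq_add_cos_sq (2 * (i : ℝ)), Real.sin_sq_add_cos_sq (2 * (j : ℝ))]

theorem axisPoint_injective : Function.Injective axisPoint := by
  intro s t h
  simpa [axisPoint] using congrArg (fun x : Euc 3 => x 2) h

theorem circlePoint_injective : Function.Injective circlePoint := by
  intro i j h
  have hd := dist_circlePoint_circlePoint i j
  rw [h, dist_self, eq_comm, Real.sqrt_eq_zero (by linarith [Real.cos_le_one (2 * (i : ℝ) - 2 * j)])]
    at hd
  obtain ⟨k, hk⟩ := (Real.cos_eq_one_iff (2 * (i : ℝ) - 2 * j)).1 (by linarith)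
  by_cases hk0 : k = 0
  · subst hk0
    have : (i : ℝ) = j := by push_cast at hk; linarith
    exact_mod_cast this
  · exfalso
    have hk0' : (k : ℝ) ≠ 0 := by exact_mod_cast hk0
    refine irrational_pi ⟨((i : ℚ) - j) / k, ?_⟩
    push_cast
    field_simp
    linarith

theorem axisPoint_ne_circlePoint (t : ℝ) (j : ℕ) : axisPoint t ≠ circlePoint j := by
  intro h
  have h1 := dist_axisPoint_circlePoint t j
  rw [h, dist_self] at h1
  have : 0 < √(1 + t ^ 2) := by positivity
  linarith

theorem suspensionRadius_axisPoint (t : ℝ) : suspensionRadius (axisPoint t) = √(1 + t ^ 2) := by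
  simp [suspensionRadius, axisPoint]

theorem suspensionRadius_circlePoint (j : ℕ) :
    suspensionRadius (circlePoint j) = √(2 - 2 * Real.cos 2) := by
  have h := Real.sin_sq_add_cos_sq (2 * (j : ℝ))
  rw [suspensionRadius, if_neg]
  rintro ⟨h0, h1⟩
  simp only [circlePoint] at h0 h1
  simp at h0 h1
  rw [h0, h1] at h
  norm_num at h

theorem suspensionRadius_pos (x : Euc 3) : 0 < suspensionRadius x := by
  unfold suspensionRadius
  split_ifs
  · positivity
  · exact Real.sqrt_pos.2 (by linarith [Real.cos_two_neg])

theorem dist_circlePoint_succ (j : ℕ) :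
    dist (circlePoint j) (circlePoint (j + 1)) = √(2 - 2 * Real.cos 2) := by
  rw [dist_circlePoint_circlePoint, ← Real.cos_neg 2]
  congr 4
  push_cast
  ring

theorem dist_circlePoint_axisPoint_of_sq_eq {t : ℝ} (ht : t ^ 2 = axisHeight ^ 2) (j : ℕ) :
    dist (circlePoint j) (axisPoint t) = √(2 - 2 * Real.cos 2) := by
  rw [dist_comm, dist_axisPoint_circlePoint, ht, axisHeight_sq]
  congr 1
  ring

open Classical in
/-- The points `circlePoint j`, `j < c`, together with the first `a` points of `axisSeq`. -/
noncomputable def suspensionSet (a c : ℕ) : Finset (Euc 3) :=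
  (Finset.range c).image circlePoint ∪ (Finset.range a).image fun i => axisPoint (axisSeq i)

theorem circlePoint_mem_suspensionSet {a c j : ℕ} (hj : j < c) :
    circlePoint j ∈ suspensionSet a c :=
  Finset.mem_union_left _ (Finset.mem_image_of_mem _ (Finset.mem_range.2 hj))

theorem axisPoint_mem_suspensionSet {a c i : ℕ} (hi : i < a) :
    axisPoint (axisSeq i) ∈ suspensionSet a c :=
  Finset.mem_union_right _ (Finset.mem_image_of_mem (fun i => axisPoint (axisSeq i))
    (Finset.mem_range.2 hi))

theorem axisPoint_axisSeq_injective : Function.Injective fun i => axisPoint (axisSeq i) :=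
  axisPoint_injective.comp strictMono_axisSeq.injective

theorem disjoint_circlePoint_axisPoint (a c : ℕ) :
    Disjoint ((Finset.range c).image circlePoint)
      ((Finset.range a).image fun i => axisPoint (axisSeq i)) := by
  refine Finset.disjoint_left.2 fun x hx hx' => ?_
  obtain ⟨j, -, rfl⟩ := Finset.mem_image.1 hx
  obtain ⟨i, -, h⟩ := Finset.mem_image.1 hx'
  exact axisPoint_ne_circlePoint _ _ h

theorem card_suspensionSet (a c : ℕ) : (suspensionSet a c).card = c + a := by
  rw [suspensionSet, Finset.card_union_of_disjoint (disjoint_circlePoint_axisPoint a c),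
    Finset.card_image_of_injective _ circlePoint_injective,
    Finset.card_image_of_injective _ axisPoint_axisSeq_injective, Finset.card_range,
    Finset.card_range]

theorem favouriteCount_eq_sum {d : ℕ} (S : Finset (Euc d)) (r : Euc d → ℝ) :
    favouriteCount S r = ∑ x ∈ S, (S.filter fun y => dist x y = r x).card := by
  rw [favouriteCount, favouriteArcs, Finset.card_filter, Finset.sum_product]
  simp only [Finset.card_filter]

theorem four_le_card_of_circlePoint {a c j : ℕ} (ha : 2 ≤ a) (hj : j + 2 < c) :
    4 ≤ ((suspensionSet a c).filter fun y =>
      dist (circlePoint (j + 1)) y = suspensionRadius (circlePoint (j + 1))).card := by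
  classical
  have hsub : ({circlePoint j, circlePoint (j + 2), axisPoint (axisSeq 0),
      axisPoint (axisSeq 1)} : Finset (Euc 3)) ⊆ (suspensionSet a c).filter fun y =>
      dist (circlePoint (j + 1)) y = suspensionRadius (circlePoint (j + 1)) := by
    intro y hy
    simp only [Finset.mem_insert, Finset.mem_singleton] at hy
    rw [Finset.mem_filter, suspensionRadius_circlePoint]
    rcases hy with rfl | rfl | rfl | rfl
    · exact ⟨circlePoint_mem_suspensionSet (by omega), by rw [dist_comm, dist_circlePoint_succ]⟩
    · exact ⟨circlePoint_mem_suspensionSet (by omega), dist_circlePoint_succ (j + 1)⟩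
    · exact ⟨axisPoint_mem_suspensionSet (by omega),
        dist_circlePoint_axisPoint_of_sq_eq (neg_sq axisHeight) _⟩
    · exact ⟨axisPoint_mem_suspensionSet (by omega), dist_circlePoint_axisPoint_of_sq_eq rfl _⟩
  refine le_trans (le_of_eq ?_) (Finset.card_le_card hsub)
  have h1 : circlePoint j ≠ circlePoint (j + 2) := circlePoint_injective.ne (by omega)
  have h2 : axisPoint (axisSeq 0) ≠ axisPoint (axisSeq 1) :=
    axisPoint_axisSeq_injective.ne (by omega)
  have h3 := fun t j => (axisPoint_ne_circlePoint t j).symm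
  rw [Finset.card_insert_of_notMem (by simp [h1, h3]), Finset.card_insert_of_notMem (by simp [h3]),
    Finset.card_pair h2]

theorem card_le_card_of_axisPoint (a c i : ℕ) :
    c ≤ ((suspensionSet a c).filter fun y =>
      dist (axisPoint (axisSeq i)) y = suspensionRadius (axisPoint (axisSeq i))).card := by
  classical
  have hsub : (Finset.range c).image circlePoint ⊆ (suspensionSet a c).filter fun y =>
      dist (axisPoint (axisSeq i)) y = suspensionRadius (axisPoint (axisSeq i)) := by
    intro y hy
    obtain ⟨j, hj, rfl⟩ := Finset.mem_image.1 hy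
    rw [Finset.mem_filter, suspensionRadius_axisPoint]
    exact ⟨circlePoint_mem_suspensionSet (Finset.mem_range.1 hj), dist_axisPoint_circlePoint _ _⟩
  refine le_trans (le_of_eq ?_) (Finset.card_le_card hsub)
  rw [Finset.card_image_of_injective _ circlePoint_injective, Finset.card_range]

theorem succ_card_le_card_of_axisPoint {a c i : ℕ} (hi : i + 2 < a) :
    c + 1 ≤ ((suspensionSet a c).filter fun y =>
      dist (axisPoint (axisSeq (i + 1))) y = suspensionRadius (axisPoint (axisSeq (i + 1)))).card := by
  classical
  have hsub : insert (axisPoint (axisSeq (i + 2))) ((Finset.range c).image circlePoint) ⊆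
      (suspensionSet a c).filter fun y =>
      dist (axisPoint (axisSeq (i + 1))) y = suspensionRadius (axisPoint (axisSeq (i + 1))) := by
    intro y hy
    rw [Finset.mem_filter, suspensionRadius_axisPoint]
    rcases Finset.mem_insert.1 hy with rfl | hy
    · refine ⟨axisPoint_mem_suspensionSet hi, ?_⟩
      rw [dist_axisPoint_axisPoint, axisSeq, sub_add_cancel_left, abs_neg, abs_of_nonneg]
      positivity
    · obtain ⟨j, hj, rfl⟩ := Finset.mem_image.1 hy
      exact ⟨circlePoint_mem_suspensionSet (Finset.mem_range.1 hj), dist_axisPoint_circlePoint _ _⟩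
  refine le_trans (le_of_eq ?_) (Finset.card_le_card hsub)
  rw [Finset.card_insert_of_notMem, Finset.card_image_of_injective _ circlePoint_injective,
    Finset.card_range]
  intro h
  obtain ⟨j, -, h⟩ := Finset.mem_image.1 h
  exact axisPoint_ne_circlePoint _ _ h.symm

theorem le_favouriteCount_suspensionSet (a c : ℕ) :
    4 * c + (a + 2) * (c + 2) + a ≤
      favouriteCount (suspensionSet (a + 2) (c + 2)) suspensionRadius := by
  classical
  set S := suspensionSet (a + 2) (c + 2) with hS
  set D : Euc 3 → ℕ := fun x => (S.filter fun y => dist x y = suspensionRadius x).card with hD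
  have hsum : favouriteCount S suspensionRadius =
      ∑ j ∈ Finset.range (c + 2), D (circlePoint j) +
        ∑ i ∈ Finset.range (a + 2), D (axisPoint (axisSeq i)) := by
    rw [favouriteCount_eq_sum, hS, suspensionSet,
      Finset.sum_union (disjoint_circlePoint_axisPoint _ _),
      Finset.sum_image circlePoint_injective.injOn,
      Finset.sum_image (axisPoint_axisSeq_injective.injOn)]
    rfl
  have hc : 4 * c ≤ ∑ j ∈ Finset.range (c + 2), D (circlePoint j) := by
    rw [Finset.sum_range_succ, Finset.sum_range_succ']
    have : c • 4 ≤ ∑ j ∈ Finset.range c, D (circlePoint (j + 1)) := by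
      refine le_trans (le_of_eq (by simp)) (Finset.card_nsmul_le_sum (Finset.range c) _ 4 ?_)
      intro j hj
      exact four_le_card_of_circlePoint (by omega) (by have := Finset.mem_range.1 hj; omega)
    rw [smul_eq_mul] at this
    omega
  have ha : (a + 2) * (c + 2) + a ≤ ∑ i ∈ Finset.range (a + 2), D (axisPoint (axisSeq i)) := by
    rw [Finset.sum_range_succ, Finset.sum_range_succ']
    have h1 : a • (c + 3) ≤ ∑ i ∈ Finset.range a, D (axisPoint (axisSeq (i + 1))) := by
      refine le_trans (le_of_eq (by simp)) (Finset.card_nsmul_le_sum (Finset.range a) _ (c + 3) ?_)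
      intro i hi
      exact succ_card_le_card_of_axisPoint (by have := Finset.mem_range.1 hi; omega)
    have h2 : c + 2 ≤ D (axisPoint (axisSeq 0)) := card_le_card_of_axisPoint _ _ _
    have h3 : c + 2 ≤ D (axisPoint (axisSeq (a + 1))) := card_le_card_of_axisPoint _ _ _
    rw [smul_eq_mul] at h1
    nlinarith
  omega

/-- The lower bound `f₃(n) ≥ n² / 4 + 5n / 2 - O(1)`. -/
theorem le_favouriteMax {n : ℕ} (hn : 10 ≤ n) : n ^ 2 + 10 * n ≤ 4 * favouriteMax 3 n + 32 := by
  -- the sizes balance the product `(a + 4) * (c + 1)` for `a` points on the axis and `c` others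
  obtain ⟨c, hc⟩ : ∃ c, c = (n + 3) / 2 - 2 := ⟨_, rfl⟩
  obtain ⟨a, ha⟩ : ∃ a, a = n - c - 4 := ⟨_, rfl⟩
  have hcard : (suspensionSet (a + 2) (c + 2)).card = n := by
    rw [card_suspensionSet]
    omega
  have h1 := le_favouriteCount_suspensionSet a c
  have h2 : favouriteCount (suspensionSet (a + 2) (c + 2)) suspensionRadius ≤ favouriteMax 3 n :=
    (favouriteMax_isGreatest 3 n).2 ⟨_, _, hcard, fun x _ => suspensionRadius_pos x, rfl⟩
  rcases Nat.even_or_odd' n with ⟨m, rfl | rfl⟩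
  · obtain ⟨m, rfl⟩ : ∃ k, m = k + 5 := ⟨m - 5, by omega⟩
    obtain rfl : c = m + 4 := by omega
    obtain rfl : a = m + 2 := by omega
    nlinarith
  · obtain ⟨m, rfl⟩ : ∃ k, m = k + 5 := ⟨m - 5, by omega⟩
    obtain rfl : c = m + 5 := by omega
    obtain rfl : a = m + 2 := by omega
    nlinarith

/-! ### Arcs between a circle, its axis, and the remaining points -/

section Suspension

open Classical in
/-- The points of `S` on the circle. -/
noncomputable def circlePart (S : Finset (Euc 3)) (Γ : Circle3) : Finset (Euc 3) :=
  S.filter fun x => x ∈ Γ.points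

open Classical in
/-- The points of `S` on the axis of the circle whose sphere contains the circle. -/
noncomputable def axisPart (S : Finset (Euc 3)) (r : Euc 3 → ℝ) (Γ : Circle3) : Finset (Euc 3) :=
  S.filter fun x => x ∈ Γ.axis ∧ ∀ z ∈ Γ.points, dist x z = r x

open Classical in
/-- The points of `S` to be removed in order to obtain a suspension. -/
noncomputable def exceptionalPart (S : Finset (Euc 3)) (r : Euc 3 → ℝ) (Γ : Circle3) :
    Finset (Euc 3) :=
  S \ (axisPart S r Γ ∪ circlePart S Γ)

variable {S : Finset (Euc 3)} {r : Euc 3 → ℝ} {Γ : Circle3}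

theorem mem_circlePart {x : Euc 3} : x ∈ circlePart S Γ ↔ x ∈ S ∧ x ∈ Γ.points := by
  simp [circlePart]

theorem mem_axisPart {x : Euc 3} :
    x ∈ axisPart S r Γ ↔ x ∈ S ∧ x ∈ Γ.axis ∧ ∀ z ∈ Γ.points, dist x z = r x := by
  simp [axisPart]

theorem mem_exceptionalPart {x : Euc 3} :
    x ∈ exceptionalPart S r Γ ↔ x ∈ S ∧ x ∉ axisPart S r Γ ∧ x ∉ circlePart S Γ := by
  simp [exceptionalPart]

theorem disjoint_axisPart_circlePart : Disjoint (axisPart S r Γ) (circlePart S Γ) :=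
  Finset.disjoint_left.2 fun _ h h' =>
    Γ.disjoint_points_axis (mem_axisPart.1 h).2.1 (mem_circlePart.1 h').2

theorem sum_axisPart_add_circlePart_add_exceptionalPart (f : Euc 3 → ℕ) :
    ∑ x ∈ S, f x = ∑ x ∈ axisPart S r Γ, f x + ∑ x ∈ circlePart S Γ, f x +
      ∑ x ∈ exceptionalPart S r Γ, f x := by
  classical
  rw [← Finset.sum_union disjoint_axisPart_circlePart, add_comm, exceptionalPart,
    Finset.sum_sdiff]
  exact Finset.union_subset (fun x hx => (mem_axisPart.1 hx).1) fun x hx => (mem_circlePart.1 hx).1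

theorem card_axisPart_add_card_circlePart_add_card_exceptionalPart :
    (axisPart S r Γ).card + (circlePart S Γ).card + (exceptionalPart S r Γ).card = S.card := by
  have := sum_axisPart_add_circlePart_add_exceptionalPart (S := S) (r := r) (Γ := Γ) fun _ => 1
  simpa using this.symm

theorem isSuspensionWith_sdiff_exceptionalPart (hr : ∀ x ∈ S, 0 < r x)
    (hC : (circlePart S Γ).Nonempty) :
    IsSuspensionWith Γ ((S : Set (Euc 3)) \ (exceptionalPart S r Γ : Set (Euc 3))) r := by
  obtain ⟨z, hz⟩ := hC
  have hz := (mem_circlePart.1 hz).2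
  have hmem : ∀ x ∈ (S : Set (Euc 3)) \ (exceptionalPart S r Γ : Set (Euc 3)),
      x ∈ axisPart S r Γ ∨ x ∈ circlePart S Γ := by
    rintro x ⟨hx, hxT⟩
    by_contra! h
    exact hxT (mem_exceptionalPart.2 ⟨hx, h⟩)
  refine ⟨S.finite_toSet.subset Set.sdiff_subset, fun x hx => hr x hx.1, fun x hx => ?_, ?_⟩
  · rcases hmem x hx with h | h
    · exact Or.inr (mem_axisPart.1 h).2.1
    · exact Or.inl (mem_circlePart.1 h).2
  · rintro x ⟨hx, hxL⟩
    rcases hmem x hx with h | h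
    · rw [Γ.infDist_eq_dist_of_mem_axis hxL hz, (mem_axisPart.1 h).2.2 z hz]
    · exact absurd (mem_circlePart.1 h).2 (Γ.disjoint_points_axis hxL)

/-- Every point has at most two arcs to the axis. -/
theorem card_filter_axisPart_le (p : Euc 3) :
    ((axisPart S r Γ).filter fun y => dist p y = r p).card ≤ 2 := by
  by_contra! h
  obtain ⟨y₁, h₁, y₂, h₂, y₃, h₃, h12, h13, h23⟩ := exists_three_of_three_le_card h
  simp only [Finset.mem_filter, mem_axisPart] at h₁ h₂ h₃
  exact Γ.not_three_axis_equidistant h12 h13 h23 h₁.1.2.1 h₂.1.2.1 h₃.1.2.1 h₁.2 h₂.2 h₃.2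

/-- A point that is not in the axis part has at most two arcs to the circle. -/
theorem card_filter_circlePart_le {p : Euc 3} (hpS : p ∈ S) (hp : p ∉ axisPart S r Γ) :
    ((circlePart S Γ).filter fun y => dist p y = r p).card ≤ 2 := by
  by_contra! h
  obtain ⟨y₁, h₁, y₂, h₂, y₃, h₃, h12, h13, h23⟩ := exists_three_of_three_le_card h
  simp only [Finset.mem_filter, mem_circlePart] at h₁ h₂ h₃
  have hax := Γ.mem_axis_of_equidistant h12 h13 h23 h₁.1.2 h₂.1.2 h₃.1.2 h₁.2 h₂.2 h₃.2
  refine hp (mem_axisPart.2 ⟨hpS, hax, fun z hz => ?_⟩)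
  rw [Γ.dist_eq_dist_of_mem_axis hax hz h₁.1.2, h₁.2]

/-- A point not on the circle receives at most one arc from the axis part, because the spheres
around the points of the axis that contain the circle are disjoint elsewhere. -/
theorem card_filter_axisPart_dist_le_one (hC : (circlePart S Γ).Nonempty) {y : Euc 3} (hy : y ∈ S)
    (hyC : y ∉ circlePart S Γ) :
    ((axisPart S r Γ).filter fun x => dist x y = r x).card ≤ 1 := by
  obtain ⟨z, hz⟩ := hC
  have hz := (mem_circlePart.1 hz).2
  by_contra! h
  obtain ⟨x, hx, x', hx', hne⟩ := Finset.one_lt_card.1 h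
  simp only [Finset.mem_filter, mem_axisPart] at hx hx'
  refine hyC (mem_circlePart.2 ⟨hy, Γ.mem_points_of_dist_eq hx.1.2.1 hx'.1.2.1 hne hz ?_ ?_⟩)
  · rw [hx.2, hx.1.2.2 z hz]
  · rw [hx'.2, hx'.1.2.2 z hz]

theorem card_filter_le_add (p : Euc 3) :
    (S.filter fun y => dist p y = r p).card ≤
      ((axisPart S r Γ).filter fun y => dist p y = r p).card +
      ((circlePart S Γ).filter fun y => dist p y = r p).card +
      ((exceptionalPart S r Γ).filter fun y => dist p y = r p).card := by
  simp only [Finset.card_filter]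
  exact (sum_axisPart_add_circlePart_add_exceptionalPart _).le

/-- The number of arcs starting on the axis. -/
theorem sum_axisPart_card_le (hC : (circlePart S Γ).Nonempty) :
    ∑ x ∈ axisPart S r Γ, (S.filter fun y => dist x y = r x).card ≤
      (axisPart S r Γ).card * (circlePart S Γ).card +
        ((axisPart S r Γ).card + (exceptionalPart S r Γ).card) := by
  classical
  set A := axisPart S r Γ
  set C := circlePart S Γ with hCdef
  set T := exceptionalPart S r Γ
  have hsplit : ∀ x ∈ A, (S.filter fun y => dist x y = r x).card ≤
      C.card + ((A ∪ T).filter fun y => dist x y = r x).card := by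
    intro x _
    have hsub : (S.filter fun y => dist x y = r x) ⊆
        C ∪ (A ∪ T).filter fun y => dist x y = r x := by
      intro y hy
      obtain ⟨hyS, hd⟩ := Finset.mem_filter.1 hy
      by_cases hyC : y ∈ C
      · exact Finset.mem_union_left _ hyC
      · refine Finset.mem_union_right _ (Finset.mem_filter.2 ⟨?_, hd⟩)
        by_cases hyA : y ∈ A
        · exact Finset.mem_union_left _ hyA
        · exact Finset.mem_union_right _ (mem_exceptionalPart.2 ⟨hyS, hyA, hyC⟩)
    exact (Finset.card_le_card hsub).trans (Finset.card_union_le _ _)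
  have hdouble := Finset.sum_card_bipartiteAbove_eq_sum_card_bipartiteBelow (s := A) (t := A ∪ T)
    (fun x y => dist x y = r x)
  simp only [Finset.bipartiteAbove, Finset.bipartiteBelow] at hdouble
  have hone : ∑ y ∈ A ∪ T, (A.filter fun x => dist x y = r x).card ≤ ∑ y ∈ A ∪ T, 1 := by
    refine Finset.sum_le_sum fun y hy => ?_
    rcases Finset.mem_union.1 hy with h | h
    · exact card_filter_axisPart_dist_le_one hC (mem_axisPart.1 h).1
        (Finset.disjoint_left.1 disjoint_axisPart_circlePart h)
    · have h := mem_exceptionalPart.1 h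
      exact card_filter_axisPart_dist_le_one hC h.1 h.2.2
  calc _ ≤ ∑ x ∈ A, (C.card + ((A ∪ T).filter fun y => dist x y = r x).card) :=
        Finset.sum_le_sum hsplit
    _ ≤ A.card * C.card + (A ∪ T).card := by
        rw [Finset.sum_add_distrib, hdouble, Finset.sum_const, smul_eq_mul]
        simpa using hone
    _ ≤ _ := Nat.add_le_add_left (Finset.card_union_le _ _) _

/-- The number of arcs starting on the circle. -/
theorem sum_circlePart_card_le :
    ∑ x ∈ circlePart S Γ, (S.filter fun y => dist x y = r x).card ≤
      4 * (circlePart S Γ).card +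
        ∑ x ∈ circlePart S Γ, ((exceptionalPart S r Γ).filter fun y => dist x y = r x).card := by
  calc _ ≤ ∑ x ∈ circlePart S Γ,
        (4 + ((exceptionalPart S r Γ).filter fun y => dist x y = r x).card) := by
        refine Finset.sum_le_sum fun x hx => ?_
        have h1 := card_filter_le_add (S := S) (r := r) (Γ := Γ) x
        have h2 := card_filter_axisPart_le (S := S) (r := r) (Γ := Γ) x
        have h3 := card_filter_circlePart_le (r := r) (mem_circlePart.1 hx).1
          (Finset.disjoint_right.1 disjoint_axisPart_circlePart hx)
        omega
    _ = _ := by rw [Finset.sum_add_distrib, Finset.sum_const, smul_eq_mul, mul_comm]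

/-- The number of arcs starting in exceptional points. -/
theorem sum_exceptionalPart_card_le :
    ∑ x ∈ exceptionalPart S r Γ, (S.filter fun y => dist x y = r x).card ≤
      (exceptionalPart S r Γ).card * (4 + (exceptionalPart S r Γ).card) := by
  rw [← smul_eq_mul]
  refine Finset.sum_le_card_nsmul _ _ _ fun x hx => ?_
  have h := mem_exceptionalPart.1 hx
  have h1 := card_filter_le_add (S := S) (r := r) (Γ := Γ) x
  have h2 := card_filter_axisPart_le (S := S) (r := r) (Γ := Γ) x
  have h3 := card_filter_circlePart_le h.1 h.2.1
  have h4 := Finset.card_filter_le (exceptionalPart S r Γ) fun y => dist x y = r x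
  omega

/-- Each triple of exceptional points has at most two common in-neighbours on the circle. -/
theorem sum_circlePart_choose_le (T : Finset (Euc 3)) :
    ∑ x ∈ circlePart S Γ, (T.filter fun y => dist x y = r x).card.choose 3 ≤
      2 * T.card.choose 3 := by
  classical
  have hdouble := Finset.sum_card_bipartiteAbove_eq_sum_card_bipartiteBelow (s := circlePart S Γ)
    (t := T.powersetCard 3) (fun x t => ∀ y ∈ t, dist x y = r x)
  simp only [Finset.bipartiteAbove, Finset.bipartiteBelow] at hdouble
  have hleft : ∀ x, (T.filter fun y => dist x y = r x).card.choose 3 =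
      ((T.powersetCard 3).filter fun t => ∀ y ∈ t, dist x y = r x).card := by
    intro x
    rw [← Finset.card_powersetCard]
    congr 1
    ext t
    simp only [Finset.mem_powersetCard, Finset.mem_filter, Finset.subset_iff]
    constructor
    · exact fun h => ⟨⟨fun y hy => (h.1 hy).1, h.2⟩, fun y hy => (h.1 hy).2⟩
    · exact fun h => ⟨fun y hy => ⟨h.1.1 hy, h.2 y hy⟩, h.1.2⟩
  simp only [hleft]
  rw [hdouble, ← Finset.card_powersetCard, mul_comm, ← smul_eq_mul]
  refine Finset.sum_le_card_nsmul _ _ _ fun t ht => ?_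
  by_contra! h
  obtain ⟨y₁, h₁, y₂, h₂, y₃, h₃, h12, h13, h23⟩ := exists_three_of_three_le_card h
  obtain ⟨z₁, k₁, z₂, k₂, z₃, k₃, k12, k13, k23⟩ :=
    exists_three_of_three_le_card (Finset.mem_powersetCard.1 ht).2.ge
  simp only [Finset.mem_filter, mem_circlePart] at h₁ h₂ h₃
  have hcen : ∀ y ∈ Γ.points, dist Γ.center y = Γ.radius := fun y hy => by rw [dist_comm, hy.1]
  exact not_three_arcs_three_arcs h12 h13 h23 k12 k13 k23 (hcen _ h₁.1.2) (hcen _ h₂.1.2)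
    (hcen _ h₃.1.2) (h₁.2 _ k₁) (h₁.2 _ k₂) (h₁.2 _ k₃) (h₂.2 _ k₁) (h₂.2 _ k₂) (h₂.2 _ k₃)
    (h₃.2 _ k₁) (h₃.2 _ k₂) (h₃.2 _ k₃)

end Suspension

/-! ### Optimising the count -/

theorem six_mul_choose_three (d : ℕ) : 6 * (d + 2).choose 3 = (d + 2) * (d + 1) * d := by
  have h := Nat.descFactorial_eq_factorial_mul_choose (d + 2) 3
  simp only [Nat.descFactorial, Nat.factorial] at h
  have h0 : d + 2 - 0 = d + 2 := rfl
  have h1 : d + 2 - 1 = d + 1 := rfl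
  have h2 : d + 2 - 2 = d := rfl
  rw [h0, h1, h2] at h
  linarith

theorem six_mul_choose_three_le (k : ℕ) : 6 * k.choose 3 ≤ k ^ 3 := by
  rcases k with _ | _ | k
  · simp
  · decide
  · rw [six_mul_choose_three]
    nlinarith [Nat.zero_le k]

theorem le_two_add_choose_three (d : ℕ) : d ≤ 2 + d.choose 3 := by
  rcases d with _ | _ | d
  · simp
  · decide
  · have h := six_mul_choose_three d
    rcases d with _ | _ | _ | d
    · simp
    · decide
    · decide
    · have h1 : 6 * (d + 3) ≤ (d + 5) * (d + 4) * (d + 3) := Nat.mul_le_mul_right _ (by nlinarith)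
      simp only [add_assoc, Nat.reduceAdd] at h ⊢
      omega

/-- If the cubic term is small on average, then so is the excess of `d` over `k / 4`. -/
theorem four_mul_sq_mul_le {k : ℕ} (hk : 16 ≤ k) (d : ℕ) :
    4 * k ^ 2 * d ≤ k ^ 3 + 1024 * d.choose 3 := by
  by_cases hd : 4 * d ≤ k
  · calc 4 * k ^ 2 * d = k ^ 2 * (4 * d) := by ring
      _ ≤ k ^ 2 * k := Nat.mul_le_mul_left _ hd
      _ ≤ k ^ 3 + 1024 * d.choose 3 := by rw [pow_succ k 2]; exact Nat.le_add_right _ _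
  · obtain ⟨m, rfl⟩ : ∃ m, d = m + 2 := ⟨d - 2, by omega⟩
    have hm : 3 ≤ m := by omega
    have h := six_mul_choose_three m
    have h1 : k ^ 2 ≤ (4 * (m + 2)) ^ 2 := Nat.pow_le_pow_left (by omega) 2
    have h2 : 4 * k ^ 2 * (m + 2) ≤ 4 * (4 * (m + 2)) ^ 2 * (m + 2) :=
      Nat.mul_le_mul_right _ (Nat.mul_le_mul_left _ h1)
    have h3 : 3 * (m + 2) ^ 2 ≤ 8 * ((m + 1) * m) := by nlinarith
    have h4 : 3 * (m + 2) ^ 2 * (m + 2) ≤ 8 * ((m + 1) * m) * (m + 2) := Nat.mul_le_mul_right _ h3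
    nlinarith

/-- The inequality that bounds the number of exceptional points: `a`, `c` and `k` are the numbers of
points on the axis, of points on the circle, and of exceptional points, and `d` gives the numbers of
arcs from the points of the circle to exceptional points. -/
theorem card_exceptional_le_two {ι : Type*} {C : Finset ι} {d : ι → ℕ} {a k n e : ℕ}
    (hn : a + C.card + k = n) (hn0 : 10 ^ 15 ≤ n) (hk : 20 * k ≤ n)
    (hd : ∑ x ∈ C, (d x).choose 3 ≤ 2 * k.choose 3)
    (he : e ≤ a * C.card + (a + k) + (4 * C.card + ∑ x ∈ C, d x) + k * (4 + k))
    (hlow : n ^ 2 + 10 * n ≤ 4 * e + 32) : k ≤ 2 := by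
  by_contra! hk3
  have hck := six_mul_choose_three_le k
  have hkpos : 0 < k := by omega
  by_cases hk16 : k < 16
  · -- each point of the circle has two arcs to exceptional points, up to a bounded error
    have hD : ∑ x ∈ C, d x ≤ 2 * C.card + 4096 := by
      have h1 : ∑ x ∈ C, d x ≤ ∑ x ∈ C, (2 + (d x).choose 3) :=
        Finset.sum_le_sum fun x _ => le_two_add_choose_three _
      rw [Finset.sum_add_distrib, Finset.sum_const, smul_eq_mul] at h1
      have h2 : k ^ 3 ≤ 16 ^ 3 := Nat.pow_le_pow_left hk16.le 3
      omega
    generalize ∑ x ∈ C, d x = D at *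
    generalize C.card = c at *
    have h1 := four_mul_le_sq_add (a + 6) (c + 1)
    have h2 : (a + 6 + (c + 1)) ^ 2 ≤ (n + 4) ^ 2 := Nat.pow_le_pow_left (by omega) 2
    have h3 : k * (4 + k) ≤ 15 * 19 := Nat.mul_le_mul (by omega) (by omega)
    nlinarith
  · -- each point of the circle has `k / 4` arcs to exceptional points, up to a bounded average error
    have hD : 4 * ∑ x ∈ C, d x ≤ C.card * k + 342 * k := by
      have h1 : ∑ x ∈ C, 4 * k ^ 2 * d x ≤ ∑ x ∈ C, (k ^ 3 + 1024 * (d x).choose 3) :=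
        Finset.sum_le_sum fun x _ => four_mul_sq_mul_le (not_lt.1 hk16) _
      rw [Finset.sum_add_distrib, Finset.sum_const, smul_eq_mul, ← Finset.mul_sum,
        ← Finset.mul_sum] at h1
      have h2 : k ^ 2 * (4 * ∑ x ∈ C, d x) ≤ k ^ 2 * (C.card * k + 342 * k) := by
        have : k ^ 3 = k ^ 2 * k := pow_succ k 2
        nlinarith
      exact Nat.le_of_mul_le_mul_left h2 (by positivity)
    generalize ∑ x ∈ C, d x = D at *
    generalize C.card = c at *
    have h1 : 4 * ((a : ℝ) + 4 + k / 4) * (c + 1) ≤ (n + 5 - 3 * k / 4) ^ 2 := by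
      have : (a : ℝ) + c + k = n := by exact_mod_cast hn
      rw [← this]
      nlinarith [sq_nonneg ((a : ℝ) + 3 + k / 4 - c)]
    have h2 : 20 * (k : ℝ) * k ≤ n * k := by
      have : (20 * k * k : ℝ) ≤ n * k := by exact_mod_cast Nat.mul_le_mul_right k hk
      exact this
    have h3 : (10 : ℝ) ^ 15 * k ≤ n * k := by exact_mod_cast Nat.mul_le_mul_right k hn0
    have h4 : (e : ℝ) ≤ a * c + (a + k) + (4 * c + D) + k * (4 + k) := by exact_mod_cast he
    have h5 : (n : ℝ) ^ 2 + 10 * n ≤ 4 * e + 32 := by exact_mod_cast hlow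
    have h6 : 4 * (D : ℝ) ≤ c * k + 342 * k := by exact_mod_cast hD
    have h7 : (3 : ℝ) ≤ k := by exact_mod_cast hk3
    nlinarith

/-! ### Structure of the extremal sets -/

theorem commonNbrsClosed_dist (r : Euc 3 → ℝ) : CommonNbrsClosed fun x z => dist x z = r x :=
  fun _ _ _ _ _ _ _ hne h12 h13 h23 h1 h2 h3 h1' h2' h3' h1'' h2'' h3'' h h' =>
    dist_eq_of_three_common hne h12 h13 h23 h1 h2 h3 h1' h2' h3' h1'' h2'' h3'' h h'

theorem noTripleJoin_dist (r : Euc 3 → ℝ) : NoTripleJoin fun x z => dist x z = r x :=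
  fun _ _ _ _ _ _ _ => not_three_arcs_three_arcs

/-- The stability result: if there are at least `n² / 4` arcs, then all but a small proportion of
the points form a suspension. -/
theorem exists_circle_of_sq_card_le {S : Finset (Euc 3)} {r : Euc 3 → ℝ} (hr : ∀ x ∈ S, 0 < r x)
    (hn : 10 ^ 15 ≤ S.card) (hS : S.card ^ 2 ≤ 4 * favouriteCount S r) :
    ∃ Γ : Circle3, (circlePart S Γ).Nonempty ∧
      19 * S.card ≤ 20 * ((axisPart S r Γ).card + (circlePart S Γ).card) := by
  classical
  have harcs : favouriteCount S r = (arcsOn S fun x z => dist x z = r x).card := by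
    rw [favouriteCount, favouriteArcs, arcsOn]
  rw [harcs] at hS
  obtain ⟨x, hx, x', hx', hne, h3, hcard⟩ := exists_dominant_circle (commonNbrsClosed_dist r)
    (noTripleJoin_dist r) (fun x hx h => (hr x hx).ne (by rw [← h, dist_self])) hn hS
  set P := outNbrs S (fun x z => dist x z = r x) x ∩ outNbrs S (fun x z => dist x z = r x) x'
  obtain ⟨z₁, hz₁, z₂, hz₂, z₃, hz₃, h12, h13, h23⟩ := exists_three_of_three_le_card h3
  have hP : ∀ z ∈ P, z ∈ S ∧ dist x z = r x ∧ dist x' z = r x' := by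
    intro z hz
    obtain ⟨h, h'⟩ := Finset.mem_inter.1 hz
    exact ⟨(mem_outNbrs.1 h).1, (mem_outNbrs.1 h).2, (mem_outNbrs.1 h').2⟩
  obtain ⟨Γ, c₁, c₂, c₃⟩ := exists_circle_of_equidistant h12 h13 h23 (hP _ hz₁).2.1 (hP _ hz₂).2.1
    (hP _ hz₃).2.1
  have hxΓ := Γ.mem_axis_of_equidistant h12 h13 h23 c₁ c₂ c₃ (hP _ hz₁).2.1 (hP _ hz₂).2.1
    (hP _ hz₃).2.1
  have hxΓ' := Γ.mem_axis_of_equidistant h12 h13 h23 c₁ c₂ c₃ (hP _ hz₁).2.2 (hP _ hz₂).2.2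
    (hP _ hz₃).2.2
  have hPC : P ⊆ circlePart S Γ := by
    intro z hz
    refine mem_circlePart.2 ⟨(hP z hz).1, Γ.mem_points_of_dist_eq hxΓ hxΓ' hne c₁ ?_ ?_⟩
    · rw [(hP z hz).2.1, (hP _ hz₁).2.1]
    · rw [(hP z hz).2.2, (hP _ hz₁).2.2]
  have hLA : commonIn S (fun x z => dist x z = r x) P ⊆ axisPart S r Γ := by
    intro u hu
    obtain ⟨huS, hu⟩ := mem_commonIn.1 hu
    have huΓ := Γ.mem_axis_of_equidistant h12 h13 h23 c₁ c₂ c₃ (hu _ hz₁) (hu _ hz₂) (hu _ hz₃)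
    refine mem_axisPart.2 ⟨huS, huΓ, fun z hz => ?_⟩
    rw [Γ.dist_eq_dist_of_mem_axis huΓ hz c₁, hu _ hz₁]
  refine ⟨Γ, ⟨z₁, hPC hz₁⟩, hcard.trans (Nat.mul_le_mul_left _ (Nat.add_le_add ?_ ?_))⟩
  · exact Finset.card_le_card hLA
  · exact Finset.card_le_card hPC

theorem mainTheorem2 :
    ∃ n₀ : ℕ, ∀ (S : Finset (Euc 3)) (r : Euc 3 → ℝ),
      (∀ x ∈ S, 0 < r x) →
      n₀ ≤ S.card →
      favouriteCount S r = favouriteMax 3 S.card →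
      ∃ T : Finset (Euc 3), T ⊆ S ∧ T.card ≤ 2 ∧
        ∃ C : Circle3, IsSuspensionWith C ((S : Set (Euc 3)) \ (T : Set (Euc 3))) r := by
  refine ⟨10 ^ 15, fun S r hr hn hmax => ?_⟩
  have hlow := le_favouriteMax (n := S.card) (by omega)
  rw [← hmax] at hlow
  obtain ⟨Γ, hC, hcard⟩ := exists_circle_of_sq_card_le hr hn (by omega)
  have hpart := card_axisPart_add_card_circlePart_add_card_exceptionalPart (S := S) (r := r) (Γ := Γ)
  refine ⟨exceptionalPart S r Γ, fun x hx => (mem_exceptionalPart.1 hx).1, ?_, Γ,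
    isSuspensionWith_sdiff_exceptionalPart hr hC⟩
  refine card_exceptional_le_two hpart hn (by omega)
    (sum_circlePart_choose_le (r := r) (exceptionalPart S r Γ)) ?_ hlow
  rw [favouriteCount_eq_sum,
    sum_axisPart_add_circlePart_add_exceptionalPart (S := S) (r := r) (Γ := Γ)]
  exact Nat.add_le_add (Nat.add_le_add (sum_axisPart_card_le hC) sum_circlePart_card_le)
    sum_exceptionalPart_card_le
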